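/- Let $\Sigma$ be a first-order signature, let $\mathrm{Var}$ be the countably infinite set of variables, and let terms be the $\Sigma$-terms over $\mathrm{Var}$. Models are $\Sigma$-structures $M$ with at least two elements; equality is a logical symbol. A team over $M$ is a set $X$ of assignments $s:\mathrm{Var}\to M$. For $F:X\to M$ put $X[F/v]=\{s[F(s)/v]: s\in X\}$, and put $X[M/v]=\{s[m/v]: s\in X,\ m\in M\}$. A literal is one of $R\vec t$, $\neg R\vec t$, $t=t'$, $t\neq t'$; a team satisfies a literal if each of its assignments does. A team satisfies the dependence atom ${=}(t_1,\dots,t_n)$ ($n\ge 1$) if any two of its assignments that agree on $t_1,\dots,t_{n-1}$ agree on $t_n$. **Dependence Logic (DL)** has formulas $\phi ::= \text{literal}\mid{=}(t_1,\dots,t_n)\mid\phi\vee\phi\mid\phi\wedge\phi\mid\exists v\,\phi\mid\forall v\,\phi$. Here $M\models_X\phi\vee\psi$ iff $X=Y\cup Z$ for some teams with $M\models_Y\phi$ and $M\models_Z\psi$; $M\models_X\phi\wedge\psi$ iff $M\models_X\phi$ and $M\models_X\psi$; $M\models_X\exists v\,\phi$ iff $M\models_{X[F/v]}\phi$ for some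 $F:X\to M$; $M\models_X\forall v\,\phi$ iff $M\models_{X[M/v]}\phi$. **Dynamic Dependence Logic (DDL)** has formulas $\tau ::= \text{literal}\mid{=}(t_1,\dots,t_n)\mid\exists v\mid\forall v\mid\tau\otimes\tau\mid\tau\cap\tau\mid\tau;\tau$. The relation $M\models_{X\to Y}\tau$ ($\tau$ allows the transition from $X$ to $Y$) is defined by: if $\tau$ is a literal or a dependence atom, $X$ satisfies $\tau$ and $X\subseteq Y$; for $\exists v$, $X[F/v]\subseteq Y$ for some $F:X\to M$; for $\forall v$, $X[M/v]\subseteq Y$; for $\tau_1\otimes\tau_2$, $X=X_1\cup X_2$ for some teams with $M\models_{X_1\to Y}\tau_1$ and $M\models_{X_2\to Y}\tau_2$; for $\tau_1\cap\tau_2$, $M\models_{X\to Y}\tau_1$ and $M\models_{X\to Y}\tau_2$; for $\tau_1;\tau_2$, $M\models_{X\to Z}\tau_1$ and $M\models_{Z\to Y}\tau_2$ for some team $Z$. Satisfaction $M\models_X\tau$ means that $M\models_{X\to Y}\tau$ for some team $Y$. **Transition Dependence Logic (TDL)** has transition terms $\tau ::= \exists v\mid\forall v\mid\phi?\mid\tau\otimes\tau\mid\tau\cap\tau\mid\tau;\tau$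 and formulas $\phi ::= \text{literal}\mid{=}(t_1,\dots,t_n)\mid\phi\vee\phi\mid\phi\wedge\phi\mid\langle\tau\rangle\phi$. The clauses for $\exists v,\forall v,\otimes,\cap,;$ are those of DDL; $M\models_{X\to Y}\phi?$ iff $M\models_X\phi$ and $X\subseteq Y$; literals and dependence atoms are satisfied as above; $M\models_X\phi\vee\psi$ iff $M\models_X\phi$ or $M\models_X\psi$; $M\models_X\phi\wedge\psi$ iff both hold; and $M\models_X\langle\tau\rangle\phi$ iff $M\models_{X\to Y}\tau$ and $M\models_Y\phi$ for some team $Y$. **Corollary.** Over every signature $\Sigma$, the formulas of DDL, of TDL and of DL have the same expressive power on satisfaction: for any two of these three logics and every formula $\phi$ of the first over $\Sigma$ there is a formula $\phi'$ of the second over $\Sigma$ such that, for all $\Sigma$-structures $M$ with at least two elements and all teams $X$ over $M$ with domain $\mathrm{Var}$, $M\models_X\phi$ if and only if $M\models_X\phi'$. -/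

import Mathlib

universe u v w

/-- Teams over `M`, with domain the (countably infinite) set of all variables, here `ℕ`:
sets of assignments of elements of `M` to the variables. -/
abbrev Team (M : Type w) : Type w := Set (ℕ → M)

namespace Team

variable {M : Type w}

/-- `X[F/v] = {s[F(s)/v] : s ∈ X}`. Only the values of `F` on `X` matter. -/
def supplement (X : Team M) (F : (ℕ → M) → M) (v : ℕ) : Team M :=
  {s' | ∃ s ∈ X, s' = Function.update s v (F s)}

/-- `X[M/v] = {s[m/v] : s ∈ X, m ∈ M}`. -/
def duplicate (X : Team M) (v : ℕ) : Team M :=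
  {s' | ∃ s ∈ X, ∃ m : M, s' = Function.update s v m}

end Team

/-- First-order literals over the signature `L`, with variables in `ℕ`; equality is a
logical symbol. -/
inductive FOLiteral (L : FirstOrder.Language.{u, v}) : Type (max u v)
  | rel {n : ℕ} (R : L.Relations n) (ts : Fin n → L.Term ℕ) : FOLiteral L
  | negRel {n : ℕ} (R : L.Relations n) (ts : Fin n → L.Term ℕ) : FOLiteral L
  | eq (t₁ t₂ : L.Term ℕ) : FOLiteral L
  | ne (t₁ t₂ : L.Term ℕ) : FOLiteral L

/-- Tarskian satisfaction `M ⊨ₛ α` of a literal by an assignment. -/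
def FOLiteral.Holds {L : FirstOrder.Language.{u, v}} {M : Type w} [L.Structure M] :
    FOLiteral L → (ℕ → M) → Prop
  | .rel R ts, s => FirstOrder.Language.Structure.RelMap R (fun i => (ts i).realize s)
  | .negRel R ts, s => ¬ FirstOrder.Language.Structure.RelMap R (fun i => (ts i).realize s)
  | .eq t₁ t₂, s => t₁.realize s = t₂.realize s
  | .ne t₁ t₂, s => t₁.realize s ≠ t₂.realize s

/-- The condition expressed by the dependence atom `=(ts₁, …, tsₖ, t)` on a team: any two
assignments of the team that agree on all of `ts` agree on `t`. -/
def Team.Dep {L : FirstOrder.Language.{u, v}} {M : Type w} [L.Structure M]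
    (X : Team M) {k : ℕ} (ts : Fin k → L.Term ℕ) (t : L.Term ℕ) : Prop :=
  ∀ s ∈ X, ∀ s' ∈ X, (∀ i, (ts i).realize s = (ts i).realize s') → t.realize s = t.realize s'

/-- Formulas of Dependence Logic, in negation normal form.
`dep ts t` is the dependence atom `=(ts₁, …, tsₖ, t)`, for any `k ≥ 0`. -/
inductive DL (L : FirstOrder.Language.{u, v}) : Type (max u v)
  | lit (α : FOLiteral L) : DL L
  | dep {k : ℕ} (ts : Fin k → L.Term ℕ) (t : L.Term ℕ) : DL L
  | or (φ ψ : DL L) : DL L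
  | and (φ ψ : DL L) : DL L
  | ex (v : ℕ) (φ : DL L) : DL L
  | all (v : ℕ) (φ : DL L) : DL L

/-- Team semantics of Dependence Logic: `φ.Sat X` is `M ⊨_X φ`. -/
def DL.Sat {L : FirstOrder.Language.{u, v}} {M : Type w} [L.Structure M] :
    DL L → Team M → Prop
  | .lit α, X => ∀ s ∈ X, α.Holds s
  | .dep ts t, X => X.Dep ts t
  | .or φ ψ, X => ∃ Y Z : Team M, X = Y ∪ Z ∧ φ.Sat Y ∧ ψ.Sat Z
  | .and φ ψ, X => φ.Sat X ∧ ψ.Sat X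
  | .ex v φ, X => ∃ F : (ℕ → M) → M, φ.Sat (X.supplement F v)
  | .all v φ, X => φ.Sat (X.duplicate v)

mutual

/-- Transition terms of Transition Dependence Logic. -/
inductive TDLTerm (L : FirstOrder.Language.{u, v}) : Type (max u v)
  | ex (v : ℕ) : TDLTerm L
  | all (v : ℕ) : TDLTerm L
  | test (φ : TDL L) : TDLTerm L
  | tensor (τ₁ τ₂ : TDLTerm L) : TDLTerm L
  | inter (τ₁ τ₂ : TDLTerm L) : TDLTerm L
  | seq (τ₁ τ₂ : TDLTerm L) : TDLTerm L

/-- Formulas of Transition Dependence Logic. -/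
inductive TDL (L : FirstOrder.Language.{u, v}) : Type (max u v)
  | lit (α : FOLiteral L) : TDL L
  | dep {k : ℕ} (ts : Fin k → L.Term ℕ) (t : L.Term ℕ) : TDL L
  | or (φ ψ : TDL L) : TDL L
  | and (φ ψ : TDL L) : TDL L
  | dia (τ : TDLTerm L) (φ : TDL L) : TDL L

end

mutual

/-- `τ.Allows X Y` is `M ⊨_{X → Y} τ` for transition terms of Transition Dependence Logic. -/
def TDLTerm.Allows {L : FirstOrder.Language.{u, v}} {M : Type w} [L.Structure M] :
    TDLTerm L → Team M → Team M → Prop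
  | .ex v, X, Y => ∃ F : (ℕ → M) → M, X.supplement F v ⊆ Y
  | .all v, X, Y => X.duplicate v ⊆ Y
  | .test φ, X, Y => φ.Sat X ∧ X ⊆ Y
  | .tensor τ₁ τ₂, X, Y => ∃ X₁ X₂ : Team M, X = X₁ ∪ X₂ ∧ τ₁.Allows X₁ Y ∧ τ₂.Allows X₂ Y
  | .inter τ₁ τ₂, X, Y => τ₁.Allows X Y ∧ τ₂.Allows X Y
  | .seq τ₁ τ₂, X, Y => ∃ Z : Team M, τ₁.Allows X Z ∧ τ₂.Allows Z Y

/-- `φ.Sat X` is `M ⊨_X φ` for formulas of Transition Dependence Logic; here `or` is the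
classical disjunction. -/
def TDL.Sat {L : FirstOrder.Language.{u, v}} {M : Type w} [L.Structure M] :
    TDL L → Team M → Prop
  | .lit α, X => ∀ s ∈ X, α.Holds s
  | .dep ts t, X => X.Dep ts t
  | .or φ ψ, X => φ.Sat X ∨ ψ.Sat X
  | .and φ ψ, X => φ.Sat X ∧ ψ.Sat X
  | .dia τ φ, X => ∃ Y : Team M, τ.Allows X Y ∧ φ.Sat Y

end

/-- Formulas of Dynamic Dependence Logic. -/
inductive DDL (L : FirstOrder.Language.{u, v}) : Type (max u v)
  | lit (α : FOLiteral L) : DDL L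
  | dep {k : ℕ} (ts : Fin k → L.Term ℕ) (t : L.Term ℕ) : DDL L
  | ex (v : ℕ) : DDL L
  | all (v : ℕ) : DDL L
  | tensor (τ₁ τ₂ : DDL L) : DDL L
  | inter (τ₁ τ₂ : DDL L) : DDL L
  | seq (τ₁ τ₂ : DDL L) : DDL L

/-- `τ.Allows X Y` is `M ⊨_{X → Y} τ` for formulas of Dynamic Dependence Logic. -/
def DDL.Allows {L : FirstOrder.Language.{u, v}} {M : Type w} [L.Structure M] :
    DDL L → Team M → Team M → Prop
  | .lit α, X, Y => (∀ s ∈ X, α.Holds s) ∧ X ⊆ Y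
  | .dep ts t, X, Y => X.Dep ts t ∧ X ⊆ Y
  | .ex v, X, Y => ∃ F : (ℕ → M) → M, X.supplement F v ⊆ Y
  | .all v, X, Y => X.duplicate v ⊆ Y
  | .tensor τ₁ τ₂, X, Y => ∃ X₁ X₂ : Team M, X = X₁ ∪ X₂ ∧ τ₁.Allows X₁ Y ∧ τ₂.Allows X₂ Y
  | .inter τ₁ τ₂, X, Y => τ₁.Allows X Y ∧ τ₂.Allows X Y
  | .seq τ₁ τ₂, X, Y => ∃ Z : Team M, τ₁.Allows X Z ∧ τ₂.Allows Z Y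

/-- `τ.Sat X` is `M ⊨_X τ`: some transition from `X` is allowed by `τ`. -/
def DDL.Sat {L : FirstOrder.Language.{u, v}} {M : Type w} [L.Structure M]
    (τ : DDL L) (X : Team M) : Prop :=
  ∃ Y : Team M, τ.Allows X Y

open Filter FirstOrder

namespace Team

variable {M : Type w}

/-- Every assignment of `X` agrees below `n` with some assignment of `Y`. -/
def CoveredBelow (n : ℕ) (X Y : Team M) : Prop :=
  ∀ s ∈ X, ∃ s' ∈ Y, ∀ i < n, s' i = s i

/-- The assignments that agree below `n` with some assignment of `Y`. -/
def saturation (n : ℕ) (Y : Team M) : Team M :=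
  {s | ∃ s' ∈ Y, ∀ i < n, s' i = s i}

theorem CoveredBelow.of_subset {n : ℕ} {X Y : Team M} (h : X ⊆ Y) : CoveredBelow n X Y :=
  fun s hs => ⟨s, h hs, fun _ _ => rfl⟩

theorem saturation_mono {n : ℕ} {X Y : Team M} (h : X ⊆ Y) :
    saturation n X ⊆ saturation n Y := by
  rintro s ⟨s', hs', e⟩
  exact ⟨s', h hs', e⟩

theorem CoveredBelow.supplement {n : ℕ} {X Y : Team M} (h : CoveredBelow n X Y)
    (F : (ℕ → M) → M) (v : ℕ) :
    ∃ F' : (ℕ → M) → M, CoveredBelow n (X.supplement F' v) (Y.supplement F v) := by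
  choose! f hf using h
  refine ⟨fun s => F (f s), ?_⟩
  rintro _ ⟨s, hs, rfl⟩
  refine ⟨_, ⟨f s, (hf s hs).1, rfl⟩, fun i hi => ?_⟩
  by_cases hv : i = v
  · subst hv; simp
  · simp [hv, (hf s hs).2 i hi]

theorem CoveredBelow.duplicate {n : ℕ} {X Y : Team M} (h : CoveredBelow n X Y) (v : ℕ) :
    CoveredBelow n (X.duplicate v) (Y.duplicate v) := by
  rintro _ ⟨s, hs, m, rfl⟩
  obtain ⟨s', hs', e⟩ := h s hs
  refine ⟨_, ⟨s', hs', m, rfl⟩, fun i hi => ?_⟩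
  by_cases hv : i = v
  · subst hv; simp
  · simp [hv, e i hi]

theorem CoveredBelow.exists_union {n : ℕ} {X Y₁ Y₂ : Team M} (h : CoveredBelow n X (Y₁ ∪ Y₂)) :
    ∃ X₁ X₂ : Team M, X = X₁ ∪ X₂ ∧ CoveredBelow n X₁ Y₁ ∧ CoveredBelow n X₂ Y₂ := by
  refine ⟨X ∩ saturation n Y₁, X ∩ saturation n Y₂, ?_, fun s hs => hs.2, fun s hs => hs.2⟩
  rw [← Set.inter_union_distrib_left, eq_comm, Set.inter_eq_left]
  intro s hs
  obtain ⟨s', hs' | hs', e⟩ := h s hs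
  · exact Or.inl ⟨s', hs', e⟩
  · exact Or.inr ⟨s', hs', e⟩

theorem supplement_mono {X Y : Team M} (h : X ⊆ Y) (F : (ℕ → M) → M) (v : ℕ) :
    X.supplement F v ⊆ Y.supplement F v := by
  rintro _ ⟨s, hs, rfl⟩
  exact ⟨s, h hs, rfl⟩

theorem duplicate_mono {X Y : Team M} (h : X ⊆ Y) (v : ℕ) :
    X.duplicate v ⊆ Y.duplicate v := by
  rintro _ ⟨s, hs, m, rfl⟩
  exact ⟨s, h hs, m, rfl⟩

end Team

open Team

section Locality

variable {L : FirstOrder.Language.{u, v}}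

theorem FirstOrder.Language.Term.eventually_realize_congr (t : L.Term ℕ) :
    ∀ᶠ n in atTop, ∀ (M : Type w) [L.Structure M] (s s' : ℕ → M), (∀ i < n, s i = s' i) →
      t.realize s = t.realize s' := by
  induction t with
  | var i =>
    filter_upwards [eventually_gt_atTop i] with n hn M _ s s' h
    exact h i hn
  | func f ts ih =>
    filter_upwards [eventually_all.2 ih] with n hn M _ s s' h
    simp only [Language.Term.realize_func]
    congr 1
    funext i
    exact hn i M s s' h

theorem FOLiteral.eventually_holds_congr (α : FOLiteral L) :
    ∀ᶠ n in atTop, ∀ (M : Type w) [L.Structure M] (s s' : ℕ → M), (∀ i < n, s i = s' i) →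
      (α.Holds s ↔ α.Holds s') := by
  cases α with
  | rel R ts =>
    filter_upwards [eventually_all.2 fun i => (ts i).eventually_realize_congr.{u, v, w}] with n hn M _ s s' h
    simp only [FOLiteral.Holds, fun i => hn i M s s' h]
  | negRel R ts =>
    filter_upwards [eventually_all.2 fun i => (ts i).eventually_realize_congr.{u, v, w}] with n hn M _ s s' h
    simp only [FOLiteral.Holds, fun i => hn i M s s' h]
  | eq t₁ t₂ =>
    filter_upwards [t₁.eventually_realize_congr.{u, v, w}, t₂.eventually_realize_congr.{u, v, w}] with n h₁ h₂ M _ s s' h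
    simp only [FOLiteral.Holds, h₁ M s s' h, h₂ M s s' h]
  | ne t₁ t₂ =>
    filter_upwards [t₁.eventually_realize_congr.{u, v, w}, t₂.eventually_realize_congr.{u, v, w}] with n h₁ h₂ M _ s s' h
    simp only [FOLiteral.Holds, h₁ M s s' h, h₂ M s s' h]

theorem FOLiteral.eventually_forall_holds_of_coveredBelow (α : FOLiteral L) :
    ∀ᶠ n in atTop, ∀ (M : Type w) [L.Structure M] (X Y : Team M), CoveredBelow n X Y →
      (∀ s ∈ Y, α.Holds s) → ∀ s ∈ X, α.Holds s := by
  filter_upwards [α.eventually_holds_congr] with n hn M _ X Y h hY s hs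
  obtain ⟨s', hs', e⟩ := h s hs
  exact (hn M s' s e).1 (hY s' hs')

theorem Team.Dep.eventually_of_coveredBelow {k : ℕ} (ts : Fin k → L.Term ℕ) (t : L.Term ℕ) :
    ∀ᶠ n in atTop, ∀ (M : Type w) [L.Structure M] (X Y : Team M), CoveredBelow n X Y →
      Y.Dep ts t → X.Dep ts t := by
  filter_upwards [eventually_all.2 fun i => (ts i).eventually_realize_congr,
    t.eventually_realize_congr] with n hts ht M _ X Y h hY s₁ hs₁ s₂ hs₂ e
  obtain ⟨s₁', hs₁', e₁⟩ := h s₁ hs₁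
  obtain ⟨s₂', hs₂', e₂⟩ := h s₂ hs₂
  rw [← ht M _ _ e₁, ← ht M _ _ e₂]
  refine hY _ hs₁' _ hs₂' fun i => ?_
  rw [hts i M _ _ e₁, hts i M _ _ e₂, e i]

/-- Dependence Logic is local and downward closed. -/
theorem DL.eventually_sat_of_coveredBelow (φ : DL L) :
    ∀ᶠ n in atTop, ∀ (M : Type w) [L.Structure M] (X Y : Team M), CoveredBelow n X Y →
      φ.Sat Y → φ.Sat X := by
  induction φ with
  | lit α => exact α.eventually_forall_holds_of_coveredBelow
  | dep ts t => exact Team.Dep.eventually_of_coveredBelow ts t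
  | or φ ψ ihφ ihψ =>
    filter_upwards [ihφ, ihψ] with n hφ hψ M _ X Y h hY
    obtain ⟨Y₁, Y₂, rfl, h₁, h₂⟩ := hY
    obtain ⟨X₁, X₂, rfl, c₁, c₂⟩ := h.exists_union
    exact ⟨X₁, X₂, rfl, hφ M _ _ c₁ h₁, hψ M _ _ c₂ h₂⟩
  | and φ ψ ihφ ihψ =>
    filter_upwards [ihφ, ihψ] with n hφ hψ M _ X Y h hY
    exact ⟨hφ M _ _ h hY.1, hψ M _ _ h hY.2⟩
  | ex v φ ih =>
    filter_upwards [ih] with n hφ M _ X Y h hY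
    obtain ⟨F, hF⟩ := hY
    obtain ⟨F', hF'⟩ := h.supplement F v
    exact ⟨F', hφ M _ _ hF' hF⟩
  | all v φ ih =>
    filter_upwards [ih] with n hφ M _ X Y h hY
    exact hφ M _ _ (h.duplicate v) hY

theorem DL.Sat.mono {M : Type w} [L.Structure M] {φ : DL L} {X Y : Team M} (hY : φ.Sat Y)
    (h : X ⊆ Y) : φ.Sat X := by
  obtain ⟨n, hn⟩ := φ.eventually_sat_of_coveredBelow.exists
  exact hn M X Y (.of_subset h) hY

theorem DL.sat_empty {M : Type w} [L.Structure M] (φ : DL L) : φ.Sat (∅ : Team M) := by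
  induction φ with
  | lit α => simp [DL.Sat]
  | dep ts t => simp [DL.Sat, Team.Dep]
  | or φ ψ ihφ ihψ => exact ⟨∅, ∅, by simp, ihφ, ihψ⟩
  | and φ ψ ihφ ihψ => exact ⟨ihφ, ihψ⟩
  | ex v φ ih =>
    have h (F : (ℕ → M) → M) : Team.supplement ∅ F v = ∅ := by simp [Team.supplement]
    by_cases hM : Nonempty M
    · exact ⟨fun s => s 0, by rwa [h]⟩
    · exact ⟨fun s => (hM ⟨s 0⟩).elim, by rwa [h]⟩
  | all v φ ih =>
    have h : Team.duplicate (∅ : Team M) v = ∅ := by simp [Team.duplicate]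
    simpa [DL.Sat, h]

theorem TDLTerm.Allows.mono {M : Type w} [L.Structure M] :
    ∀ {τ : TDLTerm L} {X Y Y' : Team M}, τ.Allows X Y → Y ⊆ Y' → τ.Allows X Y'
  | .ex _, _, _, _, ⟨F, hF⟩, h => ⟨F, hF.trans h⟩
  | .all _, _, _, _, hF, h => Set.Subset.trans hF h
  | .test _, _, _, _, ⟨hφ, hX⟩, h => ⟨hφ, hX.trans h⟩
  | .tensor _ _, _, _, _, ⟨X₁, X₂, e, h₁, h₂⟩, h => ⟨X₁, X₂, e, h₁.mono h, h₂.mono h⟩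
  | .inter _ _, _, _, _, ⟨h₁, h₂⟩, h => ⟨h₁.mono h, h₂.mono h⟩
  | .seq _ _, _, _, _, ⟨Z, h₁, h₂⟩, h => ⟨Z, h₁, h₂.mono h⟩

mutual

theorem TDLTerm.eventually_allows_of_coveredBelow : ∀ τ : TDLTerm L,
    ∀ᶠ n in atTop, ∀ (M : Type w) [L.Structure M] (X Y Z : Team M), CoveredBelow n X Y →
      τ.Allows Y Z → τ.Allows X (saturation n Z)
  | .ex v => by
    refine Eventually.of_forall fun n M _ X Y Z h ⟨F, hF⟩ => ?_
    obtain ⟨F', hF'⟩ := h.supplement F v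
    exact ⟨F', fun s hs => saturation_mono hF (hF' s hs)⟩
  | .all v => by
    refine Eventually.of_forall fun n M _ X Y Z h hF => ?_
    exact fun s hs => saturation_mono hF (h.duplicate v s hs)
  | .test φ => by
    filter_upwards [TDL.eventually_sat_of_coveredBelow φ] with n hn M _ X Y Z h hY
    exact ⟨hn M X Y h hY.1, fun s hs => saturation_mono hY.2 (h s hs)⟩
  | .tensor τ₁ τ₂ => by
    filter_upwards [TDLTerm.eventually_allows_of_coveredBelow τ₁,
      TDLTerm.eventually_allows_of_coveredBelow τ₂] with n h₁ h₂ M _ X Y Z h hY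
    obtain ⟨Y₁, Y₂, rfl, hY₁, hY₂⟩ := hY
    obtain ⟨X₁, X₂, rfl, c₁, c₂⟩ := h.exists_union
    exact ⟨X₁, X₂, rfl, h₁ M _ _ _ c₁ hY₁, h₂ M _ _ _ c₂ hY₂⟩
  | .inter τ₁ τ₂ => by
    filter_upwards [TDLTerm.eventually_allows_of_coveredBelow τ₁,
      TDLTerm.eventually_allows_of_coveredBelow τ₂] with n h₁ h₂ M _ X Y Z h hY
    exact ⟨h₁ M _ _ _ h hY.1, h₂ M _ _ _ h hY.2⟩
  | .seq τ₁ τ₂ => by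
    filter_upwards [TDLTerm.eventually_allows_of_coveredBelow τ₁,
      TDLTerm.eventually_allows_of_coveredBelow τ₂] with n h₁ h₂ M _ X Y Z h hY
    obtain ⟨W, hW, hZ⟩ := hY
    exact ⟨saturation n W, h₁ M _ _ _ h hW, h₂ M _ _ _ (fun s hs => hs) hZ⟩

/-- Transition Dependence Logic is local and downward closed. -/
theorem TDL.eventually_sat_of_coveredBelow : ∀ φ : TDL L,
    ∀ᶠ n in atTop, ∀ (M : Type w) [L.Structure M] (X Y : Team M), CoveredBelow n X Y →
      φ.Sat Y → φ.Sat X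
  | .lit α => α.eventually_forall_holds_of_coveredBelow
  | .dep ts t => Team.Dep.eventually_of_coveredBelow ts t
  | .or φ ψ => by
    filter_upwards [TDL.eventually_sat_of_coveredBelow φ,
      TDL.eventually_sat_of_coveredBelow ψ] with n hφ hψ M _ X Y h hY
    exact hY.imp (hφ M _ _ h) (hψ M _ _ h)
  | .and φ ψ => by
    filter_upwards [TDL.eventually_sat_of_coveredBelow φ,
      TDL.eventually_sat_of_coveredBelow ψ] with n hφ hψ M _ X Y h hY
    exact hY.imp (hφ M _ _ h) (hψ M _ _ h)
  | .dia τ φ => by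
    filter_upwards [TDLTerm.eventually_allows_of_coveredBelow τ,
      TDL.eventually_sat_of_coveredBelow φ] with n hτ hφ M _ X Y h hY
    obtain ⟨Z, hZ, hZφ⟩ := hY
    exact ⟨saturation n Z, hτ M _ _ _ h hZ, hφ M _ _ (fun s hs => hs) hZφ⟩

end

theorem TDL.Sat.mono {M : Type w} [L.Structure M] {φ : TDL L} {X Y : Team M} (hY : φ.Sat Y)
    (h : X ⊆ Y) : φ.Sat X := by
  obtain ⟨n, hn⟩ := φ.eventually_sat_of_coveredBelow.exists
  exact hn M X Y (.of_subset h) hY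

theorem TDLTerm.Allows.anti {M : Type w} [L.Structure M] :
    ∀ {τ : TDLTerm L} {X X' Y : Team M}, τ.Allows X Y → X' ⊆ X → τ.Allows X' Y
  | .ex v, _, _, _, ⟨F, hF⟩, h => ⟨F, (supplement_mono h F v).trans hF⟩
  | .all v, _, _, _, hF, h => (duplicate_mono h v).trans hF
  | .test _, _, _, _, ⟨hφ, hX⟩, h => ⟨hφ.mono h, h.trans hX⟩
  | .tensor _ _, _, X', _, ⟨X₁, X₂, e, h₁, h₂⟩, h =>
    ⟨X' ∩ X₁, X' ∩ X₂, by rw [← Set.inter_union_distrib_left, ← e, Set.inter_eq_left.2 h],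
      h₁.anti Set.inter_subset_right, h₂.anti Set.inter_subset_right⟩
  | .inter _ _, _, _, _, ⟨h₁, h₂⟩, h => ⟨h₁.anti h, h₂.anti h⟩
  | .seq _ _, _, _, _, ⟨Z, h₁, h₂⟩, h => ⟨Z, h₁.anti h, h₂⟩

/-- A transition may be restricted to a property that does not depend on the variables which
the transition term changes. -/
theorem TDLTerm.eventually_allows_sep : ∀ τ : TDLTerm L,
    ∀ᶠ m in atTop, ∀ (M : Type w) [L.Structure M] (P : (ℕ → M) → Prop),
      (∀ s x, ∀ i < m, P s → P (Function.update s i x)) →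
      ∀ X Y : Team M, (∀ s ∈ X, P s) → τ.Allows X Y → τ.Allows X {s ∈ Y | P s}
  | .ex v => by
    filter_upwards [eventually_gt_atTop v] with m hm M _ P hP X Y hX h
    obtain ⟨F, hF⟩ := h
    refine ⟨F, fun s hs => ⟨hF hs, ?_⟩⟩
    obtain ⟨s, hs, rfl⟩ := hs
    exact hP _ _ _ hm (hX s hs)
  | .all v => by
    filter_upwards [eventually_gt_atTop v] with m hm M _ P hP X Y hX h
    refine fun s hs => ⟨h hs, ?_⟩
    obtain ⟨s, hs, x, rfl⟩ := hs
    exact hP _ _ _ hm (hX s hs)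
  | .test φ => Eventually.of_forall fun m M _ P hP X Y hX h =>
    ⟨h.1, fun s hs => ⟨h.2 hs, hX s hs⟩⟩
  | .tensor τ₁ τ₂ => by
    filter_upwards [TDLTerm.eventually_allows_sep τ₁, TDLTerm.eventually_allows_sep τ₂]
      with m h₁ h₂ M _ P hP X Y hX h
    obtain ⟨X₁, X₂, rfl, hX₁, hX₂⟩ := h
    exact ⟨X₁, X₂, rfl, h₁ M P hP _ _ (fun s hs => hX s (Or.inl hs)) hX₁,
      h₂ M P hP _ _ (fun s hs => hX s (Or.inr hs)) hX₂⟩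
  | .inter τ₁ τ₂ => by
    filter_upwards [TDLTerm.eventually_allows_sep τ₁, TDLTerm.eventually_allows_sep τ₂]
      with m h₁ h₂ M _ P hP X Y hX h
    exact ⟨h₁ M P hP _ _ hX h.1, h₂ M P hP _ _ hX h.2⟩
  | .seq τ₁ τ₂ => by
    filter_upwards [TDLTerm.eventually_allows_sep τ₁, TDLTerm.eventually_allows_sep τ₂]
      with m h₁ h₂ M _ P hP X Y hX h
    obtain ⟨Z, hZ, hY⟩ := h
    refine ⟨_, h₁ M P hP _ _ hX hZ, h₂ M P hP _ _ (fun s hs => hs.2) ?_⟩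
    exact hY.anti fun s hs => hs.1

end Locality

section Guards

variable {L : FirstOrder.Language.{u, v}} {M : Type w}

/-- The assignment `s` satisfies, for each `(p, true)` in the guard, `x_p = x_{p+1}`, and for each
`(p, false)` in the guard, `x_p ≠ x_{p+1}`. -/
def SatisfiesGuard (g : List (ℕ × Bool)) (s : ℕ → M) : Prop :=
  ∀ e ∈ g, (s e.1 = s (e.1 + 1) ↔ e.2 = true)

@[simp]
theorem satisfiesGuard_nil (s : ℕ → M) : SatisfiesGuard [] s := by simp [SatisfiesGuard]

@[simp]
theorem satisfiesGuard_cons (p : ℕ) (b : Bool) (g : List (ℕ × Bool)) (s : ℕ → M) :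
    SatisfiesGuard ((p, b) :: g) s ↔ (s p = s (p + 1) ↔ b = true) ∧ SatisfiesGuard g s := by
  simp [SatisfiesGuard]

theorem SatisfiesGuard.update {g : List (ℕ × Bool)} {m : ℕ} (hg : ∀ e ∈ g, m ≤ e.1) {s : ℕ → M}
    (h : SatisfiesGuard g s) (x : M) {i : ℕ} (hi : i < m) :
    SatisfiesGuard g (Function.update s i x) := by
  intro e he
  have := hg e he
  rw [Function.update_of_ne (by omega), Function.update_of_ne (by omega)]
  exact h e he

theorem eventually_satisfiesGuard_congr (g : List (ℕ × Bool)) :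
    ∀ᶠ n in atTop, ∀ (M : Type w) (s s' : ℕ → M), (∀ i < n, s i = s' i) →
      (SatisfiesGuard g s ↔ SatisfiesGuard g s') := by
  induction g with
  | nil => simp
  | cons e g ih =>
    filter_upwards [ih, eventually_gt_atTop (e.1 + 1)] with n hg hn M s s' h
    obtain ⟨p, b⟩ := e
    rw [satisfiesGuard_cons, satisfiesGuard_cons, hg M s s' h, h p (by grind), h (p + 1) hn]

theorem exists_guard_formulas (g : List (ℕ × Bool)) : ∃ G N : DL L,
    ∀ (M : Type w) [L.Structure M] (X : Team M),
      (G.Sat X ↔ ∀ s ∈ X, SatisfiesGuard g s) ∧ (N.Sat X ↔ ∀ s ∈ X, ¬ SatisfiesGuard g s) := by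
  induction g with
  | nil =>
    exact ⟨.lit (.eq (.var 0) (.var 0)), .lit (.ne (.var 0) (.var 0)), fun M _ X => by
      simp [DL.Sat, FOLiteral.Holds]⟩
  | cons e g ih =>
    obtain ⟨p, b⟩ := e
    obtain ⟨G, N, h⟩ := ih
    obtain ⟨α, β, hα, hβ⟩ : ∃ α β : FOLiteral L,
        (∀ (M : Type w) [L.Structure M] (s : ℕ → M),
          α.Holds s ↔ (s p = s (p + 1) ↔ b = true)) ∧
        (∀ (M : Type w) [L.Structure M] (s : ℕ → M),
          β.Holds s ↔ ¬ (s p = s (p + 1) ↔ b = true)) := by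
      cases b
      · exact ⟨.ne (.var p) (.var (p + 1)), .eq (.var p) (.var (p + 1)),
          by simp [FOLiteral.Holds], by simp [FOLiteral.Holds]⟩
      · exact ⟨.eq (.var p) (.var (p + 1)), .ne (.var p) (.var (p + 1)),
          by simp [FOLiteral.Holds], by simp [FOLiteral.Holds]⟩
    refine ⟨.and (.lit α) G, .or (.lit β) N, fun M _ X => ⟨?_, ?_⟩⟩
    · simp only [DL.Sat, hα, (h M X).1, satisfiesGuard_cons]
      grind
    · simp only [DL.Sat, hβ, (h M _).2, satisfiesGuard_cons]
      constructor
      · rintro ⟨Y, Z, rfl, hY, hZ⟩ s (hs | hs) hg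
        · exact hY s hs hg.1
        · exact hZ s hs hg.2
      · intro hX
        refine ⟨{s ∈ X | ¬ (s p = s (p + 1) ↔ b = true)}, {s ∈ X | ¬ SatisfiesGuard g s},
          ?_, fun s hs => hs.2, fun s hs => hs.2⟩
        ext s
        have := hX s
        simp only [Set.mem_union, Set.mem_ofPred_eq]
        tauto

/-- Case distinction on a guard is expressible in Dependence Logic. -/
theorem exists_guard_ite (g : List (ℕ × Bool)) (φ ψ : DL L) : ∃ χ : DL L,
    ∀ (M : Type w) [L.Structure M] (X : Team M),
      χ.Sat X ↔ φ.Sat {s ∈ X | SatisfiesGuard g s} ∧ ψ.Sat {s ∈ X | ¬ SatisfiesGuard g s} := by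
  obtain ⟨G, N, h⟩ := exists_guard_formulas.{u, v, w} (L := L) g
  refine ⟨.or (.and G φ) (.and N ψ), fun M _ X => ?_⟩
  simp only [DL.Sat, (h M _).1, (h M _).2]
  constructor
  · rintro ⟨Y, Z, rfl, ⟨hY, hφ⟩, hZ, hψ⟩
    refine ⟨hφ.mono ?_, hψ.mono ?_⟩
    · rintro s ⟨hs | hs, hg⟩
      · exact hs
      · exact (hZ s hs hg).elim
    · rintro s ⟨hs | hs, hg⟩
      · exact (hg (hY s hs)).elim
      · exact hs
  · rintro ⟨hφ, hψ⟩
    refine ⟨_, _, ?_, ⟨fun s hs => hs.2, hφ⟩, fun s hs => hs.2, hψ⟩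
    ext s
    simp only [Set.mem_union, Set.mem_ofPred_eq]
    tauto

/-- `ψ` says that some transition of `τ`, applied to the assignments that satisfy the guard only,
leads to a team that satisfies `θ`. -/
def TDLTerm.IsGuardedPrecondition (τ : TDLTerm L) (g : List (ℕ × Bool)) (θ ψ : DL L) : Prop :=
  ∀ (M : Type w) [L.Structure M] [Nontrivial M] (X : Team M),
    ψ.Sat X ↔ ∃ Y : Team M, τ.Allows {s ∈ X | SatisfiesGuard g s} Y ∧
      (∀ s ∈ Y, SatisfiesGuard g s) ∧ θ.Sat (Y ∪ {s ∈ X | ¬ SatisfiesGuard g s})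

theorem TDLTerm.exists_isGuardedPrecondition_test {φ : TDL L} {φ' : DL L}
    (h : ∀ (M : Type w) [L.Structure M] [Nontrivial M] (X : Team M), φ.Sat X ↔ φ'.Sat X)
    (g : List (ℕ × Bool)) (θ : DL L) :
    ∃ ψ, TDLTerm.IsGuardedPrecondition.{u, v, w} (.test φ) g θ ψ := by
  obtain ⟨χ, hχ⟩ := exists_guard_ite.{u, v, w} g φ' (.lit (.eq (.var 0) (.var 0)))
  refine ⟨.and χ θ, fun M _ _ X => ?_⟩
  simp only [DL.Sat, hχ, TDLTerm.Allows, ← h]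
  have key : X = {s ∈ X | SatisfiesGuard g s} ∪ {s ∈ X | ¬ SatisfiesGuard g s} := by
    ext s
    simp only [Set.mem_union, Set.mem_ofPred_eq]
    tauto
  constructor
  · rintro ⟨⟨hφ, -⟩, hθ⟩
    exact ⟨_, ⟨hφ, subset_rfl⟩, fun s hs => hs.2, by rwa [← key]⟩
  · rintro ⟨Y, ⟨hφ, hY⟩, -, hθ⟩
    refine ⟨⟨hφ, fun _ _ => rfl⟩, hθ.mono ?_⟩
    conv_lhs => rw [key]
    exact Set.union_subset_union_left _ hY

theorem TDLTerm.exists_isGuardedPrecondition_ex {v m : ℕ} (hv : v < m) {g : List (ℕ × Bool)}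
    (hg : ∀ e ∈ g, m ≤ e.1) (θ : DL L) :
    ∃ ψ, TDLTerm.IsGuardedPrecondition.{u, v, w} (.ex v) g θ ψ := by
  obtain ⟨n, hθ, hgn, hn⟩ := (θ.eventually_sat_of_coveredBelow.and
    ((eventually_satisfiesGuard_congr.{w} g).and (eventually_ge_atTop m))).exists
  obtain ⟨χ, hχ⟩ := exists_guard_ite.{u, v, w} (L := L) g (.lit (.eq (.var 0) (.var 0)))
    (.lit (.eq (.var n) (.var v)))
  refine ⟨.ex n (.and χ (.ex v (.and (.lit (.eq (.var v) (.var n))) θ))), fun M _ _ X => ?_⟩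
  have hgu (s : ℕ → M) (x : M) :
      SatisfiesGuard g (Function.update s n x) ↔ SatisfiesGuard g s :=
    hgn M _ _ fun i hi => by simp [hi.ne]
  simp only [DL.Sat, hχ, TDLTerm.Allows, FOLiteral.Holds, Language.Term.realize_var]
  have hvn : v ≠ n := by omega
  constructor
  · rintro ⟨F, ⟨-, hF⟩, F₂, hF₂, hsat⟩
    refine ⟨_, ⟨F, subset_rfl⟩, ?_, hθ M _ _ ?_ hsat⟩
    · rintro _ ⟨s, hs, rfl⟩
      exact hs.2.update hg _ hv
    · have hval (s) (hs : s ∈ X) : F₂ (Function.update s n (F s)) = F s := by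
        simpa [hvn.symm] using hF₂ _ ⟨_, ⟨s, hs, rfl⟩, rfl⟩
      rintro _ (⟨s, ⟨hs, -⟩, rfl⟩ | ⟨hs, hsg⟩)
      · refine ⟨_, ⟨_, ⟨s, hs, rfl⟩, rfl⟩, fun i hi => ?_⟩
        simp only [hval s hs, Function.update_apply]
        grind
      · rename_i s
        have := hF _ ⟨⟨s, hs, rfl⟩, by rwa [hgu]⟩
        refine ⟨_, ⟨_, ⟨s, hs, rfl⟩, rfl⟩, fun i hi => ?_⟩
        simp only [hval s hs, Function.update_apply] at this ⊢
        grind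
  · rintro ⟨Y, ⟨F, hF⟩, -, hsat⟩
    classical
    refine ⟨fun s => if SatisfiesGuard g s then F s else s v, ⟨fun _ _ => trivial, ?_⟩,
      fun s => s n, ?_, hθ M _ _ ?_ hsat⟩
    · rintro _ ⟨⟨s, hs, rfl⟩, hsg⟩
      rw [hgu] at hsg
      simp [hsg, hvn]
    · rintro _ ⟨s, -, rfl⟩
      simp [hvn.symm]
    · rintro _ ⟨_, ⟨s, hs, rfl⟩, rfl⟩
      by_cases hsg : SatisfiesGuard g s
      · refine ⟨_, Or.inl (hF ⟨s, ⟨hs, hsg⟩, rfl⟩), fun i hi => ?_⟩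
        simp only [Function.update_apply]
        grind
      · refine ⟨_, Or.inr ⟨hs, hsg⟩, fun i hi => ?_⟩
        simp only [Function.update_apply]
        grind

theorem TDLTerm.exists_isGuardedPrecondition_all {v m : ℕ} (hv : v < m) {g : List (ℕ × Bool)}
    (hg : ∀ e ∈ g, m ≤ e.1) (θ : DL L) :
    ∃ ψ, TDLTerm.IsGuardedPrecondition.{u, v, w} (.all v) g θ ψ := by
  obtain ⟨n, hθ, hgn, hn⟩ := (θ.eventually_sat_of_coveredBelow.and
    ((eventually_satisfiesGuard_congr.{w} g).and (eventually_ge_atTop m))).exists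
  obtain ⟨χ, hχ⟩ := exists_guard_ite.{u, v, w} (L := L) g (.lit (.eq (.var v) (.var n)))
    (.lit (.eq (.var 0) (.var 0)))
  obtain ⟨ψ, hψ⟩ := exists_isGuardedPrecondition_ex.{u, v, w} hv hg (.and χ θ)
  refine ⟨.all n ψ, fun M _ _ X => ?_⟩
  have hgu (s : ℕ → M) (x : M) :
      SatisfiesGuard g (Function.update s n x) ↔ SatisfiesGuard g s :=
    hgn M _ _ fun i hi => by simp [hi.ne]
  have hvn : v ≠ n := by omega
  simp only [DL.Sat, hψ M _, hχ, TDLTerm.Allows, FOLiteral.Holds, Language.Term.realize_var]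
  constructor
  · rintro ⟨Y, ⟨F, hF⟩, hY, ⟨hval, -⟩, hsat⟩
    refine ⟨_, subset_rfl, ?_, hθ M _ _ ?_ hsat⟩
    · rintro _ ⟨s, hs, x, rfl⟩
      exact hs.2.update hg _ hv
    · rintro _ (⟨s, ⟨hs, hsg⟩, x, rfl⟩ | ⟨hs, hsg⟩)
      · have hmem := hF ⟨_, ⟨⟨s, hs, x, rfl⟩, (hgu s x).2 hsg⟩, rfl⟩
        have := hval _ ⟨Or.inl hmem, hY _ hmem⟩
        refine ⟨_, Or.inl hmem, fun i hi => ?_⟩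
        simp only [Function.update_apply] at this ⊢
        grind
      · rename_i s
        exact ⟨_, Or.inr ⟨⟨s, hs, s 0, rfl⟩, by rwa [hgu]⟩, fun i hi => by simp [hi.ne]⟩
  · rintro ⟨Y, hY, -, hsat⟩
    have hsub : ∀ s ∈ Team.supplement {s ∈ X.duplicate n | SatisfiesGuard g s} (fun s => s n) v,
        SatisfiesGuard g s := by
      rintro _ ⟨s, hs, rfl⟩
      exact hs.2.update hg _ hv
    refine ⟨_, ⟨fun s => s n, subset_rfl⟩, hsub, ⟨?_, fun _ _ => trivial⟩, hθ M _ _ ?_ hsat⟩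
    · rintro s ⟨hs | hs, hsg⟩
      · obtain ⟨s, -, rfl⟩ := hs
        simp [hvn.symm]
      · exact (hs.2 hsg).elim
    · rintro _ (⟨_, ⟨⟨s, hs, x, rfl⟩, hsg⟩, rfl⟩ | ⟨⟨s, hs, x, rfl⟩, hsg⟩)
      · rw [hgu] at hsg
        refine ⟨_, Or.inl (hY ⟨s, ⟨hs, hsg⟩, x, rfl⟩), fun i hi => ?_⟩
        simp only [Function.update_apply]
        grind
      · rw [hgu] at hsg
        exact ⟨s, Or.inr ⟨hs, hsg⟩, fun i hi => by simp [hi.ne]⟩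

theorem TDLTerm.IsGuardedPrecondition.split {τ₁ τ₂ : TDLTerm L} {g : List (ℕ × Bool)} {p : ℕ}
    {θ ψ₁ ψ₂ : DL L} (h₁ : TDLTerm.IsGuardedPrecondition.{u, v, w} τ₁ ((p, true) :: g) ψ₂ ψ₁)
    (h₂ : TDLTerm.IsGuardedPrecondition.{u, v, w} τ₂ ((p, false) :: g) θ ψ₂)
    (M : Type w) [L.Structure M] [Nontrivial M] (X : Team M) :
    ψ₁.Sat X ↔ ∃ Y₁ Y₂ : Team M,
      τ₁.Allows {s ∈ X | SatisfiesGuard ((p, true) :: g) s} Y₁ ∧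
      τ₂.Allows {s ∈ X | SatisfiesGuard ((p, false) :: g) s} Y₂ ∧
      (∀ s ∈ Y₁, SatisfiesGuard ((p, true) :: g) s) ∧
      (∀ s ∈ Y₂, SatisfiesGuard ((p, false) :: g) s) ∧
      θ.Sat (Y₁ ∪ Y₂ ∪ {s ∈ X | ¬ SatisfiesGuard g s}) := by
  have e₁ (Y₁ : Team M) (h : ∀ s ∈ Y₁, SatisfiesGuard ((p, true) :: g) s) :
      {s ∈ Y₁ ∪ {s ∈ X | ¬ SatisfiesGuard ((p, true) :: g) s} |
        SatisfiesGuard ((p, false) :: g) s} = {s ∈ X | SatisfiesGuard ((p, false) :: g) s} := by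
    ext s
    have := h s
    simp only [Set.mem_union, Set.mem_ofPred_eq, satisfiesGuard_cons, Bool.false_eq_true] at this ⊢
    tauto
  have e₂ (Y₁ Y₂ : Team M) (h : ∀ s ∈ Y₁, SatisfiesGuard ((p, true) :: g) s) :
      Y₂ ∪ {s ∈ Y₁ ∪ {s ∈ X | ¬ SatisfiesGuard ((p, true) :: g) s} |
        ¬ SatisfiesGuard ((p, false) :: g) s} =
      Y₁ ∪ Y₂ ∪ {s ∈ X | ¬ SatisfiesGuard g s} := by
    ext s
    have := h s
    simp only [Set.mem_union, Set.mem_ofPred_eq, satisfiesGuard_cons, Bool.false_eq_true] at this ⊢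
    tauto
  rw [h₁ M X]
  constructor
  · rintro ⟨Y₁, hτ₁, hY₁, hψ₂⟩
    obtain ⟨Y₂, hτ₂, hY₂, hsat⟩ := (h₂ M _).1 hψ₂
    rw [e₁ _ hY₁] at hτ₂
    rw [e₂ _ _ hY₁] at hsat
    exact ⟨Y₁, Y₂, hτ₁, hτ₂, hY₁, hY₂, hsat⟩
  · rintro ⟨Y₁, Y₂, hτ₁, hτ₂, hY₁, hY₂, hsat⟩
    refine ⟨Y₁, hτ₁, hY₁, (h₂ M _).2 ⟨Y₂, ?_, hY₂, ?_⟩⟩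
    · rwa [e₁ _ hY₁]
    · rwa [e₂ _ _ hY₁]

/-- Two guarded transitions into a common team may be chosen to lead to parts of (the saturation
of) that team which satisfy the respective guards. -/
theorem TDLTerm.IsGuardedPrecondition.sat_of_allows {τ₁ τ₂ : TDLTerm L} {g : List (ℕ × Bool)}
    {p m : ℕ} {θ ψ₁ ψ₂ : DL L}
    (h₁ : TDLTerm.IsGuardedPrecondition.{u, v, w} τ₁ ((p, true) :: g) ψ₂ ψ₁)
    (h₂ : TDLTerm.IsGuardedPrecondition.{u, v, w} τ₂ ((p, false) :: g) θ ψ₂)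
    (hg : ∀ e ∈ g, m ≤ e.1) (hp : m ≤ p) [L.Structure M] [Nontrivial M]
    (hs₁ : ∀ P : (ℕ → M) → Prop, (∀ s x, ∀ i < m, P s → P (Function.update s i x)) →
      ∀ X Y : Team M, (∀ s ∈ X, P s) → τ₁.Allows X Y → τ₁.Allows X {s ∈ Y | P s})
    (hs₂ : ∀ P : (ℕ → M) → Prop, (∀ s x, ∀ i < m, P s → P (Function.update s i x)) →
      ∀ X Y : Team M, (∀ s ∈ X, P s) → τ₂.Allows X Y → τ₂.Allows X {s ∈ Y | P s})
    {X Y : Team M} (hτ₁ : τ₁.Allows {s ∈ X | SatisfiesGuard ((p, true) :: g) s} Y)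
    (hτ₂ : τ₂.Allows {s ∈ X | SatisfiesGuard ((p, false) :: g) s} Y)
    (hθ : θ.Sat (Y ∪ {s ∈ X | ¬ SatisfiesGuard g s})) : ψ₁.Sat X := by
  have hg' (b : Bool) (s : ℕ → M) (x : M) (i : ℕ) (hi : i < m)
      (hs : SatisfiesGuard ((p, b) :: g) s) :
      SatisfiesGuard ((p, b) :: g) (Function.update s i x) :=
    hs.update (List.forall_mem_cons.2 ⟨hp, hg⟩) x hi
  refine (h₁.split h₂ M X).2 ⟨_, _, hs₁ _ (hg' true) _ _ (fun s hs => hs.2) hτ₁,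
    hs₂ _ (hg' false) _ _ (fun s hs => hs.2) hτ₂, fun s hs => hs.2, fun s hs => hs.2,
    hθ.mono (Set.union_subset_union_left _ ?_)⟩
  exact Set.union_subset (fun s hs => hs.1) (fun s hs => hs.1)

theorem exists_classical_or (φ ψ : DL L) : ∃ χ : DL L,
    ∀ (M : Type w) [L.Structure M] [Nontrivial M] (X : Team M),
      χ.Sat X ↔ φ.Sat X ∨ ψ.Sat X := by
  obtain ⟨n, hφ, hψ⟩ := (φ.eventually_sat_of_coveredBelow.{u, v, w}.and
    ψ.eventually_sat_of_coveredBelow.{u, v, w}).exists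
  obtain ⟨χ, hχ⟩ := exists_guard_ite.{u, v, w} [(n, true)] φ ψ
  refine ⟨.ex n (.ex (n + 1) (.and (.and (.dep (k := 0) ![] (.var n))
    (.dep (k := 0) ![] (.var (n + 1)))) χ)), fun M _ _ X => ?_⟩
  simp only [DL.Sat, hχ, Team.Dep, Language.Term.realize_var, satisfiesGuard_cons,
    satisfiesGuard_nil, iff_true, and_true, IsEmpty.forall_iff, forall_const]
  constructor
  · rintro ⟨F, F', ⟨hn, hn'⟩, hφX, hψX⟩
    set X' := (X.supplement F n).supplement F' (n + 1) with hX'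
    have hX : CoveredBelow n X X' := by
      intro s hs
      refine ⟨_, ⟨_, ⟨s, hs, rfl⟩, rfl⟩, fun i hi => ?_⟩
      simp [hi.ne, (hi.trans (Nat.lt_succ_self n)).ne]
    by_cases h : ∃ s ∈ X', s n = s (n + 1)
    · obtain ⟨s₀, hs₀, e⟩ := h
      refine Or.inl (hφ M _ _ hX (hφX.mono fun s hs => ⟨hs, ?_⟩))
      rw [hn s hs s₀ hs₀, hn' s hs s₀ hs₀, e]
    · push Not at h
      exact Or.inr (hψ M _ _ hX (hψX.mono fun s hs => ⟨hs, h s hs⟩))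
  · obtain ⟨a, b, hab⟩ := exists_pair_ne M
    have hcov (c d : M) :
        CoveredBelow n ((X.supplement (fun _ => c) n).supplement (fun _ => d) (n + 1)) X := by
      rintro _ ⟨_, ⟨s, hs, rfl⟩, rfl⟩
      refine ⟨s, hs, fun i hi => ?_⟩
      simp [hi.ne, (hi.trans (Nat.lt_succ_self n)).ne]
    have hval (c d : M) (s : ℕ → M)
        (hs : s ∈ (X.supplement (fun _ => c) n).supplement (fun _ => d) (n + 1)) :
        s n = c ∧ s (n + 1) = d := by
      obtain ⟨_, ⟨s, hs, rfl⟩, rfl⟩ := hs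
      simp
    rintro (h | h)
    · refine ⟨fun _ => a, fun _ => a, ⟨?_, ?_⟩, (hφ M _ _ (hcov a a) h).mono fun s hs => hs.1, ?_⟩
      · intro s hs s' hs'
        rw [(hval _ _ s hs).1, (hval _ _ s' hs').1]
      · intro s hs s' hs'
        rw [(hval _ _ s hs).2, (hval _ _ s' hs').2]
      · refine ψ.sat_empty.mono fun s hs => hs.2 ?_
        rw [(hval _ _ s hs.1).1, (hval _ _ s hs.1).2]
    · refine ⟨fun _ => a, fun _ => b, ⟨?_, ?_⟩, ?_, (hψ M _ _ (hcov a b) h).mono fun s hs => hs.1⟩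
      · intro s hs s' hs'
        rw [(hval _ _ s hs).1, (hval _ _ s' hs').1]
      · intro s hs s' hs'
        rw [(hval _ _ s hs).2, (hval _ _ s' hs').2]
      · refine φ.sat_empty.mono fun s hs => hab ?_
        rw [← (hval _ _ s hs.1).1, ← (hval _ _ s hs.1).2, hs.2]

theorem TDLTerm.exists_isGuardedPrecondition_tensor {τ₁ τ₂ : TDLTerm L}
    (h₁ : ∀ᶠ m in atTop, ∀ g : List (ℕ × Bool), (∀ e ∈ g, m ≤ e.1) → ∀ θ : DL L,
      ∃ ψ, TDLTerm.IsGuardedPrecondition.{u, v, w} τ₁ g θ ψ)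
    (h₂ : ∀ᶠ m in atTop, ∀ g : List (ℕ × Bool), (∀ e ∈ g, m ≤ e.1) → ∀ θ : DL L,
      ∃ ψ, TDLTerm.IsGuardedPrecondition.{u, v, w} τ₂ g θ ψ) :
    ∀ᶠ m in atTop, ∀ g : List (ℕ × Bool), (∀ e ∈ g, m ≤ e.1) → ∀ θ : DL L,
      ∃ ψ, TDLTerm.IsGuardedPrecondition.{u, v, w} (.tensor τ₁ τ₂) g θ ψ := by
  filter_upwards [h₁, h₂, τ₁.eventually_allows_sep.{u, v, w}, τ₂.eventually_allows_sep.{u, v, w}]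
    with m h₁ h₂ hs₁ hs₂ g hg θ
  obtain ⟨n, hθ, hgn, hn, hl₁, hl₂⟩ := (θ.eventually_sat_of_coveredBelow.and
    ((eventually_satisfiesGuard_congr.{w} g).and ((eventually_ge_atTop m).and
    (τ₁.eventually_allows_of_coveredBelow.{u, v, w}.and
      τ₂.eventually_allows_of_coveredBelow.{u, v, w})))).exists
  have hg' (b : Bool) : ∀ e ∈ (n, b) :: g, m ≤ e.1 := List.forall_mem_cons.2 ⟨hn, hg⟩
  obtain ⟨ψ₂, hψ₂⟩ := h₂ _ (hg' false) θ
  obtain ⟨ψ₁, hψ₁⟩ := h₁ _ (hg' true) ψ₂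
  refine ⟨.ex n (.ex (n + 1) ψ₁), fun M _ _ X => ?_⟩
  have hagree (s : ℕ → M) (x y : M) :
      ∀ i < n, s i = Function.update (Function.update s n x) (n + 1) y i :=
    fun i hi => by simp [hi.ne, (hi.trans (Nat.lt_succ_self n)).ne]
  have hgu (s : ℕ → M) (x y : M) :
      SatisfiesGuard g (Function.update (Function.update s n x) (n + 1) y) ↔ SatisfiesGuard g s :=
    (hgn M _ _ (hagree s x y)).symm
  simp only [DL.Sat]
  constructor
  · rintro ⟨F, F', h⟩
    obtain ⟨Y₁, Y₂, hτ₁, hτ₂, hY₁, hY₂, hsat⟩ := (hψ₁.split hψ₂ M _).1 h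
    have hcov (b : Bool) : CoveredBelow n
        {s ∈ X | SatisfiesGuard g s ∧ (F s = F' (Function.update s n (F s)) ↔ b = true)}
        {s ∈ (X.supplement F n).supplement F' (n + 1) | SatisfiesGuard ((n, b) :: g) s} := by
      rintro s ⟨hs, hsg, e⟩
      refine ⟨_, ⟨⟨_, ⟨s, hs, rfl⟩, rfl⟩, ?_⟩, fun i hi => (hagree s _ _ i hi).symm⟩
      simpa [hgu, hsg] using e
    refine ⟨saturation n (Y₁ ∪ Y₂), ⟨_, _, ?_,
      (hl₁ M _ _ _ (hcov true) hτ₁).mono (saturation_mono Set.subset_union_left),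
      (hl₂ M _ _ _ (hcov false) hτ₂).mono (saturation_mono Set.subset_union_right)⟩, ?_,
      hθ M _ _ ?_ hsat⟩
    · ext s
      simp only [Set.mem_union, Set.mem_ofPred_eq, Bool.false_eq_true]
      tauto
    · rintro s ⟨s', hs' | hs', e⟩
      · exact (hgn M _ _ e).1 ((satisfiesGuard_cons _ _ _ _).1 (hY₁ _ hs')).2
      · exact (hgn M _ _ e).1 ((satisfiesGuard_cons _ _ _ _).1 (hY₂ _ hs')).2
    · rintro s (⟨s', hs', e⟩ | ⟨hs, hsg⟩)
      · exact ⟨s', Or.inl hs', e⟩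
      · exact ⟨_, Or.inr ⟨⟨_, ⟨s, hs, rfl⟩, rfl⟩, by rwa [hgu]⟩,
          fun i hi => (hagree s _ _ i hi).symm⟩
  · rintro ⟨Y, ⟨X₁, X₂, hX, hτ₁, hτ₂⟩, -, hsat⟩
    obtain ⟨a, b, hab⟩ := exists_pair_ne M
    classical
    refine ⟨fun s => if s ∈ X₁ then a else b, fun _ => a,
      hψ₁.sat_of_allows (Y := saturation n Y) hψ₂ hg hn (hs₁ M) (hs₂ M) (hl₁ M _ _ _ ?_ hτ₁)
        (hl₂ M _ _ _ ?_ hτ₂) (hθ M _ _ ?_ hsat)⟩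
    · rintro _ ⟨⟨_, ⟨s, hs, rfl⟩, rfl⟩, hsg⟩
      rw [satisfiesGuard_cons] at hsg
      refine ⟨s, ?_, hagree s _ _⟩
      by_contra hs₁
      simp [hs₁, hab.symm] at hsg
    · rintro _ ⟨⟨_, ⟨s, hs, rfl⟩, rfl⟩, hsg⟩
      rw [satisfiesGuard_cons, hgu] at hsg
      have hmem : s ∈ X₁ ∪ X₂ := hX ▸ ⟨hs, hsg.2⟩
      refine ⟨s, hmem.resolve_left fun hs₁ => ?_, hagree s _ _⟩
      simp [hs₁] at hsg
    · rintro _ (⟨s', hs', e⟩ | ⟨⟨_, ⟨s, hs, rfl⟩, rfl⟩, hsg⟩)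
      · exact ⟨s', Or.inl hs', e⟩
      · rw [hgu] at hsg
        exact ⟨s, Or.inr ⟨hs, hsg⟩, hagree s _ _⟩

theorem TDLTerm.exists_isGuardedPrecondition_inter {τ₁ τ₂ : TDLTerm L}
    (h₁ : ∀ᶠ m in atTop, ∀ g : List (ℕ × Bool), (∀ e ∈ g, m ≤ e.1) → ∀ θ : DL L,
      ∃ ψ, TDLTerm.IsGuardedPrecondition.{u, v, w} τ₁ g θ ψ)
    (h₂ : ∀ᶠ m in atTop, ∀ g : List (ℕ × Bool), (∀ e ∈ g, m ≤ e.1) → ∀ θ : DL L,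
      ∃ ψ, TDLTerm.IsGuardedPrecondition.{u, v, w} τ₂ g θ ψ) :
    ∀ᶠ m in atTop, ∀ g : List (ℕ × Bool), (∀ e ∈ g, m ≤ e.1) → ∀ θ : DL L,
      ∃ ψ, TDLTerm.IsGuardedPrecondition.{u, v, w} (.inter τ₁ τ₂) g θ ψ := by
  filter_upwards [h₁, h₂, τ₁.eventually_allows_sep.{u, v, w}, τ₂.eventually_allows_sep.{u, v, w}]
    with m h₁ h₂ hs₁ hs₂ g hg θ
  obtain ⟨n, hθ, hgn, hn, hl₁, hl₂⟩ := (θ.eventually_sat_of_coveredBelow.and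
    ((eventually_satisfiesGuard_congr.{w} g).and ((eventually_ge_atTop m).and
    (τ₁.eventually_allows_of_coveredBelow.{u, v, w}.and
      τ₂.eventually_allows_of_coveredBelow.{u, v, w})))).exists
  have hg' (b : Bool) : ∀ e ∈ (n, b) :: g, m ≤ e.1 := List.forall_mem_cons.2 ⟨hn, hg⟩
  obtain ⟨ψ₂, hψ₂⟩ := h₂ _ (hg' false) θ
  obtain ⟨ψ₁, hψ₁⟩ := h₁ _ (hg' true) ψ₂
  refine ⟨.all n (.all (n + 1) ψ₁), fun M _ _ X => ?_⟩
  have hagree (s : ℕ → M) (x y : M) :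
      ∀ i < n, s i = Function.update (Function.update s n x) (n + 1) y i :=
    fun i hi => by simp [hi.ne, (hi.trans (Nat.lt_succ_self n)).ne]
  have hgu (s : ℕ → M) (x y : M) :
      SatisfiesGuard g (Function.update (Function.update s n x) (n + 1) y) ↔ SatisfiesGuard g s :=
    (hgn M _ _ (hagree s x y)).symm
  obtain ⟨a, b, hab⟩ := exists_pair_ne M
  simp only [DL.Sat]
  constructor
  · intro h
    obtain ⟨Y₁, Y₂, hτ₁, hτ₂, hY₁, hY₂, hsat⟩ := (hψ₁.split hψ₂ M _).1 h
    have hcov (c : Bool) : CoveredBelow n {s ∈ X | SatisfiesGuard g s}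
        {s ∈ (X.duplicate n).duplicate (n + 1) | SatisfiesGuard ((n, c) :: g) s} := by
      rintro s ⟨hs, hsg⟩
      refine ⟨_, ⟨⟨_, ⟨s, hs, a, rfl⟩, if c then a else b, rfl⟩, ?_⟩,
        fun i hi => (hagree s _ _ i hi).symm⟩
      cases c <;> simp [hgu, hsg, hab]
    refine ⟨saturation n (Y₁ ∪ Y₂),
      ⟨(hl₁ M _ _ _ (hcov true) hτ₁).mono (saturation_mono Set.subset_union_left),
      (hl₂ M _ _ _ (hcov false) hτ₂).mono (saturation_mono Set.subset_union_right)⟩, ?_,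
      hθ M _ _ ?_ hsat⟩
    · rintro s ⟨s', hs' | hs', e⟩
      · exact (hgn M _ _ e).1 ((satisfiesGuard_cons _ _ _ _).1 (hY₁ _ hs')).2
      · exact (hgn M _ _ e).1 ((satisfiesGuard_cons _ _ _ _).1 (hY₂ _ hs')).2
    · rintro s (⟨s', hs', e⟩ | ⟨hs, hsg⟩)
      · exact ⟨s', Or.inl hs', e⟩
      · exact ⟨_, Or.inr ⟨⟨_, ⟨s, hs, a, rfl⟩, a, rfl⟩, by rwa [hgu]⟩,
          fun i hi => (hagree s _ _ i hi).symm⟩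
  · rintro ⟨Y, ⟨hτ₁, hτ₂⟩, -, hsat⟩
    have hcov (c : Bool) : CoveredBelow n
        {s ∈ (X.duplicate n).duplicate (n + 1) | SatisfiesGuard ((n, c) :: g) s}
        {s ∈ X | SatisfiesGuard g s} := by
      rintro _ ⟨⟨_, ⟨s, hs, x, rfl⟩, y, rfl⟩, hsg⟩
      rw [satisfiesGuard_cons, hgu] at hsg
      exact ⟨s, ⟨hs, hsg.2⟩, hagree s x y⟩
    refine hψ₁.sat_of_allows (Y := saturation n Y) hψ₂ hg hn (hs₁ M) (hs₂ M)
      (hl₁ M _ _ _ (hcov true) hτ₁) (hl₂ M _ _ _ (hcov false) hτ₂) (hθ M _ _ ?_ hsat)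
    rintro _ (⟨s', hs', e⟩ | ⟨⟨_, ⟨s, hs, x, rfl⟩, y, rfl⟩, hsg⟩)
    · exact ⟨s', Or.inl hs', e⟩
    · rw [hgu] at hsg
      exact ⟨s, Or.inr ⟨hs, hsg⟩, hagree s x y⟩

theorem TDLTerm.exists_isGuardedPrecondition_seq {τ₁ τ₂ : TDLTerm L}
    (h₁ : ∀ᶠ m in atTop, ∀ g : List (ℕ × Bool), (∀ e ∈ g, m ≤ e.1) → ∀ θ : DL L,
      ∃ ψ, TDLTerm.IsGuardedPrecondition.{u, v, w} τ₁ g θ ψ)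
    (h₂ : ∀ᶠ m in atTop, ∀ g : List (ℕ × Bool), (∀ e ∈ g, m ≤ e.1) → ∀ θ : DL L,
      ∃ ψ, TDLTerm.IsGuardedPrecondition.{u, v, w} τ₂ g θ ψ) :
    ∀ᶠ m in atTop, ∀ g : List (ℕ × Bool), (∀ e ∈ g, m ≤ e.1) → ∀ θ : DL L,
      ∃ ψ, TDLTerm.IsGuardedPrecondition.{u, v, w} (.seq τ₁ τ₂) g θ ψ := by
  filter_upwards [h₁, h₂, τ₁.eventually_allows_sep.{u, v, w}] with m h₁ h₂ hs₁ g hg θ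
  obtain ⟨ψ₂, hψ₂⟩ := h₂ g hg θ
  obtain ⟨ψ₁, hψ₁⟩ := h₁ g hg ψ₂
  refine ⟨ψ₁, fun M _ _ X => ?_⟩
  have e₁ (Z : Team M) (h : ∀ s ∈ Z, SatisfiesGuard g s) :
      {s ∈ Z ∪ {s ∈ X | ¬ SatisfiesGuard g s} | SatisfiesGuard g s} = Z := by
    ext s
    have := h s
    simp only [Set.mem_union, Set.mem_ofPred_eq]
    tauto
  have e₂ (Z : Team M) (h : ∀ s ∈ Z, SatisfiesGuard g s) :
      {s ∈ Z ∪ {s ∈ X | ¬ SatisfiesGuard g s} | ¬ SatisfiesGuard g s} =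
        {s ∈ X | ¬ SatisfiesGuard g s} := by
    ext s
    have := h s
    simp only [Set.mem_union, Set.mem_ofPred_eq]
    tauto
  rw [hψ₁ M X]
  constructor
  · rintro ⟨Z, hτ₁, hZ, h⟩
    obtain ⟨Y, hτ₂, hY, hsat⟩ := (hψ₂ M _).1 h
    rw [e₁ Z hZ] at hτ₂
    rw [e₂ Z hZ] at hsat
    exact ⟨Y, ⟨Z, hτ₁, hτ₂⟩, hY, hsat⟩
  · rintro ⟨Y, ⟨Z, hτ₁, hτ₂⟩, hY, hsat⟩
    refine ⟨_, hs₁ M _ (fun s x i hi hs => hs.update hg x hi) _ _ (fun s hs => hs.2) hτ₁,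
      fun s hs => hs.2, (hψ₂ M _).2 ⟨Y, ?_, hY, ?_⟩⟩
    · rw [e₁ _ fun s hs => hs.2]
      exact hτ₂.anti fun s hs => hs.1
    · rwa [e₂ _ fun s hs => hs.2]

end Guards

section Translations

variable {L : FirstOrder.Language.{u, v}}

mutual

theorem TDLTerm.eventually_exists_isGuardedPrecondition : ∀ τ : TDLTerm L,
    ∀ᶠ m in atTop, ∀ g : List (ℕ × Bool), (∀ e ∈ g, m ≤ e.1) → ∀ θ : DL L,
      ∃ ψ, TDLTerm.IsGuardedPrecondition.{u, v, w} τ g θ ψ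
  | .ex v => by
    filter_upwards [eventually_gt_atTop v] with m hm g hg θ
    exact TDLTerm.exists_isGuardedPrecondition_ex hm hg θ
  | .all v => by
    filter_upwards [eventually_gt_atTop v] with m hm g hg θ
    exact TDLTerm.exists_isGuardedPrecondition_all hm hg θ
  | .test φ => by
    obtain ⟨φ', h⟩ := TDL.exists_dl φ
    exact Eventually.of_forall fun m g _ θ =>
      TDLTerm.exists_isGuardedPrecondition_test h g θ
  | .tensor τ₁ τ₂ => TDLTerm.exists_isGuardedPrecondition_tensor
      (TDLTerm.eventually_exists_isGuardedPrecondition τ₁)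
      (TDLTerm.eventually_exists_isGuardedPrecondition τ₂)
  | .inter τ₁ τ₂ => TDLTerm.exists_isGuardedPrecondition_inter
      (TDLTerm.eventually_exists_isGuardedPrecondition τ₁)
      (TDLTerm.eventually_exists_isGuardedPrecondition τ₂)
  | .seq τ₁ τ₂ => TDLTerm.exists_isGuardedPrecondition_seq
      (TDLTerm.eventually_exists_isGuardedPrecondition τ₁)
      (TDLTerm.eventually_exists_isGuardedPrecondition τ₂)

theorem TDL.exists_dl : ∀ φ : TDL L, ∃ ψ : DL L,
    ∀ (M : Type w) [L.Structure M] [Nontrivial M] (X : Team M), φ.Sat X ↔ ψ.Sat X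
  | .lit α => ⟨.lit α, fun _ _ _ _ => Iff.rfl⟩
  | .dep ts t => ⟨.dep ts t, fun _ _ _ _ => Iff.rfl⟩
  | .or φ₁ φ₂ => by
    obtain ⟨ψ₁, h₁⟩ := TDL.exists_dl φ₁
    obtain ⟨ψ₂, h₂⟩ := TDL.exists_dl φ₂
    obtain ⟨χ, hχ⟩ := exists_classical_or.{u, v, w} ψ₁ ψ₂
    exact ⟨χ, fun M _ _ X => by rw [hχ, TDL.Sat, h₁, h₂]⟩
  | .and φ₁ φ₂ => by
    obtain ⟨ψ₁, h₁⟩ := TDL.exists_dl φ₁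
    obtain ⟨ψ₂, h₂⟩ := TDL.exists_dl φ₂
    exact ⟨.and ψ₁ ψ₂, fun M _ _ X => and_congr (h₁ M X) (h₂ M X)⟩
  | .dia τ φ => by
    obtain ⟨θ, hθ⟩ := TDL.exists_dl φ
    obtain ⟨m, hm⟩ := (TDLTerm.eventually_exists_isGuardedPrecondition τ).exists
    obtain ⟨ψ, hψ⟩ := hm [] (by simp) θ
    exact ⟨ψ, fun M _ _ X => by simp [hψ M X, TDL.Sat, hθ]⟩

end

/-- The transition term that corresponds to a formula of Dynamic Dependence Logic. -/
def DDL.toTDLTerm : DDL L → TDLTerm L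
  | .lit α => .test (.lit α)
  | .dep ts t => .test (.dep ts t)
  | .ex v => .ex v
  | .all v => .all v
  | .tensor τ₁ τ₂ => .tensor τ₁.toTDLTerm τ₂.toTDLTerm
  | .inter τ₁ τ₂ => .inter τ₁.toTDLTerm τ₂.toTDLTerm
  | .seq τ₁ τ₂ => .seq τ₁.toTDLTerm τ₂.toTDLTerm

theorem DDL.allows_toTDLTerm {M : Type w} [L.Structure M] (τ : DDL L) (X Y : Team M) :
    τ.toTDLTerm.Allows X Y ↔ τ.Allows X Y := by
  induction τ generalizing X Y <;>
    simp_all [DDL.toTDLTerm, TDLTerm.Allows, DDL.Allows, TDL.Sat]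

theorem DDL.exists_tdl (τ : DDL L) : ∃ φ : TDL L,
    ∀ (M : Type w) [L.Structure M] [Nontrivial M] (X : Team M), τ.Sat X ↔ φ.Sat X :=
  ⟨.dia τ.toTDLTerm (.lit (.eq (.var 0) (.var 0))), fun M _ _ X => by
    simp [DDL.Sat, TDL.Sat, DDL.allows_toTDLTerm, FOLiteral.Holds]⟩

/-- The formula of Dynamic Dependence Logic that corresponds to a formula of Dependence Logic. -/
def DL.toDDL : DL L → DDL L
  | .lit α => .lit α
  | .dep ts t => .dep ts t
  | .or φ ψ => .tensor φ.toDDL ψ.toDDL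
  | .and φ ψ => .inter φ.toDDL ψ.toDDL
  | .ex v φ => .seq (.ex v) φ.toDDL
  | .all v φ => .seq (.all v) φ.toDDL

theorem DDL.Allows.mono {M : Type w} [L.Structure M] {τ : DDL L} {X Y Y' : Team M}
    (h : τ.Allows X Y) (hY : Y ⊆ Y') : τ.Allows X Y' := by
  rw [← DDL.allows_toTDLTerm] at h ⊢
  exact TDLTerm.Allows.mono h hY

theorem DL.sat_toDDL {M : Type w} [L.Structure M] (φ : DL L) (X : Team M) :
    φ.toDDL.Sat X ↔ φ.Sat X := by
  induction φ generalizing X with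
  | lit α => exact ⟨fun ⟨Y, h⟩ => h.1, fun h => ⟨X, h, subset_rfl⟩⟩
  | dep ts t => exact ⟨fun ⟨Y, h⟩ => h.1, fun h => ⟨X, h, subset_rfl⟩⟩
  | or φ ψ ihφ ihψ =>
    simp only [DL.Sat, ← ihφ, ← ihψ]
    constructor
    · rintro ⟨Y, X₁, X₂, e, h₁, h₂⟩
      exact ⟨X₁, X₂, e, ⟨Y, h₁⟩, ⟨Y, h₂⟩⟩
    · rintro ⟨X₁, X₂, e, ⟨Y₁, h₁⟩, ⟨Y₂, h₂⟩⟩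
      exact ⟨Y₁ ∪ Y₂, X₁, X₂, e, h₁.mono Set.subset_union_left, h₂.mono Set.subset_union_right⟩
  | and φ ψ ihφ ihψ =>
    simp only [DL.Sat, ← ihφ, ← ihψ]
    constructor
    · rintro ⟨Y, h₁, h₂⟩
      exact ⟨⟨Y, h₁⟩, ⟨Y, h₂⟩⟩
    · rintro ⟨⟨Y₁, h₁⟩, ⟨Y₂, h₂⟩⟩
      exact ⟨Y₁ ∪ Y₂, h₁.mono Set.subset_union_left, h₂.mono Set.subset_union_right⟩
  | ex v φ ih =>
    constructor
    · rintro ⟨Y, Z, ⟨F, hF⟩, h⟩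
      exact ⟨F, ((ih Z).1 ⟨Y, h⟩).mono hF⟩
    · rintro ⟨F, h⟩
      obtain ⟨Y, hY⟩ := (ih _).2 h
      exact ⟨Y, _, ⟨F, subset_rfl⟩, hY⟩
  | all v φ ih =>
    constructor
    · rintro ⟨Y, Z, hF, h⟩
      have hZ : φ.Sat (X.duplicate v) := ((ih Z).1 ⟨Y, h⟩).mono hF
      exact hZ
    · intro h
      obtain ⟨Y, hY⟩ := (ih _).2 h
      exact ⟨Y, _, subset_rfl, hY⟩

end Translations

theorem mainTheorem5 (L : FirstOrder.Language.{u, v}) :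
    -- Dynamic Dependence Logic and Transition Dependence Logic
    ((∀ τ : DDL L, ∃ φ : TDL L,
        ∀ (M : Type w) [L.Structure M] [Nontrivial M] (X : Team M), τ.Sat X ↔ φ.Sat X) ∧
      (∀ φ : TDL L, ∃ τ : DDL L,
        ∀ (M : Type w) [L.Structure M] [Nontrivial M] (X : Team M), φ.Sat X ↔ τ.Sat X)) ∧
    -- Dynamic Dependence Logic and Dependence Logic
    ((∀ τ : DDL L, ∃ φ : DL L,
        ∀ (M : Type w) [L.Structure M] [Nontrivial M] (X : Team M), τ.Sat X ↔ φ.Sat X) ∧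
      (∀ φ : DL L, ∃ τ : DDL L,
        ∀ (M : Type w) [L.Structure M] [Nontrivial M] (X : Team M), φ.Sat X ↔ τ.Sat X)) ∧
    -- Transition Dependence Logic and Dependence Logic
    ((∀ φ : TDL L, ∃ ψ : DL L,
        ∀ (M : Type w) [L.Structure M] [Nontrivial M] (X : Team M), φ.Sat X ↔ ψ.Sat X) ∧
      (∀ ψ : DL L, ∃ φ : TDL L,
        ∀ (M : Type w) [L.Structure M] [Nontrivial M] (X : Team M), ψ.Sat X ↔ φ.Sat X)) := by
  have dl_ddl (φ : DL L) : ∃ τ : DDL L,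
      ∀ (M : Type w) [L.Structure M] [Nontrivial M] (X : Team M), φ.Sat X ↔ τ.Sat X :=
    ⟨φ.toDDL, fun M _ _ X => (φ.sat_toDDL X).symm⟩
  refine ⟨⟨DDL.exists_tdl, fun φ => ?_⟩, ⟨fun τ => ?_, dl_ddl⟩, ⟨TDL.exists_dl, fun ψ => ?_⟩⟩
  · obtain ⟨ψ, hψ⟩ := TDL.exists_dl.{u, v, w} φ
    obtain ⟨τ, hτ⟩ := dl_ddl ψ
    exact ⟨τ, fun M _ _ X => (hψ M X).trans (hτ M X)⟩
  · obtain ⟨φ, hφ⟩ := DDL.exists_tdl.{u, v, w} τ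
    obtain ⟨ψ, hψ⟩ := TDL.exists_dl.{u, v, w} φ
    exact ⟨ψ, fun M _ _ X => (hφ M X).trans (hψ M X)⟩
  · obtain ⟨τ, hτ⟩ := dl_ddl ψ
    obtain ⟨φ, hφ⟩ := DDL.exists_tdl.{u, v, w} τ
    exact ⟨φ, fun M _ _ X => (hτ M X).trans (hφ M X)⟩
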